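/- Consider $n$ bins, all empty at the beginning, and balls that arrive one at a time. For each ball, two bins are sampled independently and uniformly at random with replacement, and the same binary query about the load is put to both of them; each bin answers "heavy" or "light". If exactly one of the two bins is heavy, the ball is placed into the other one; otherwise it is placed into one of the two, chosen by an independent fair coin. In an adaptive $\mathrm{Quantile}(\delta)$ process a bin is heavy if its rank is at most $\delta n$, where the ranks $1,\dots,n$ order the bins by decreasing current load (ties broken arbitrarily) and $\delta \in \{1/n, 2/n, \dots, 1\}$ may be chosen before each ball as a function of the full history of the process. In an adaptive $\mathrm{Threshold}(f)$ process a bin is heavy if its current load is at least $f$, where $f$ may be chosen before each ball as a function of the full history. Let $\mathrm{Gap}(t)$ be the maximum load minus the average load $t/n$ after $t$ balls; $\log$ is the natural logarithm. (1) There is a function $\varepsilon(n) = o(n^{-2})$ such that for every $n \ge 1$ and every adaptive $\mathrm{Quantile}(\delta)$ or $\mathrm{Threshold}(f)$ process with $n$ bins, $$\Pr\left[\max_{t \in [1, n\log^2 n]} \mathrm{Gap}(t) \ge \frac18 \cdot \frac{\log n}{\log\log n}\right] \ge 1 - \varepsilon(n).$$ (2) For all sufficiently large $n$ and every adaptive $\mathrm{Quantile}(\delta)$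 or $\mathrm{Threshold}(f)$ process with $n$ bins, $$\Pr\left[\,\bigcup_{t \in [1, n\log^2 n]} \left\{\min_{s \in \left[t,\; t + \frac1{16} n \frac{\log n}{\log\log n}\right)} \mathrm{Gap}(s) \ge \frac1{16}\cdot\frac{\log n}{\log\log n}\right\}\right] \ge 1 - n^{-2}.$$ Here $t$ and $s$ range over integers. -/

import Mathlib

open MeasureTheory Filter Asymptotics

noncomputable section

namespace BallsIntoBins

/-- The randomness of one step with `n` bins: the two sampled bins and the coin that is used
when the two bins have to be distinguished at random. -/
abbrev Round (n : ℕ) : Type := Fin n × Fin n × Bool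

/-- The law of the rounds: independent steps, in each of which the two bins are independent and
uniform (with replacement) and the coin is fair and independent of the bins. -/
def roundLaw (n : ℕ) [NeZero n] : Measure (ℕ → Round n) :=
  Measure.infinitePi fun _ : ℕ => (PMF.uniformOfFintype (Round n)).toMeasure

/-- The outcomes of the first `t` rounds. -/
def past {n : ℕ} (ω : ℕ → Round n) (t : ℕ) : Fin t → Round n := fun i => ω i

open Classical in
/-- The bin receiving the ball: `heavy j` is the answer of bin `j` to the query. If exactly one
of the two sampled bins is heavy, the ball goes to the other one, otherwise the coin decides. -/
def place {n : ℕ} (heavy : Fin n → Prop) (r : Round n) : Fin n :=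
  if heavy r.1 ∧ ¬ heavy r.2.1 then r.2.1
  else if heavy r.2.1 ∧ ¬ heavy r.1 then r.1
  else if r.2.2 then r.1 else r.2.1

/-- The query of a one-query process: given the number `t` of balls allocated so far, the outcomes
of the first `t` rounds and the current load vector, which bins answer that they are heavy. -/
abbrev Query (n : ℕ) : Type := (t : ℕ) → (Fin t → Round n) → (Fin n → ℕ) → Fin n → Prop

/-- The load vector after `t` balls. -/
def load {n : ℕ} (q : Query n) (ω : ℕ → Round n) : ℕ → Fin n → ℕ
  | 0 => 0
  | t + 1 => load q ω t + Pi.single (place (q t (past ω t) (load q ω t)) (ω t)) 1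

/-- Maximum load minus average load after `t` balls. -/
def gap {n : ℕ} (q : Query n) (ω : ℕ → Round n) (t : ℕ) : ℝ :=
  ((Finset.univ.sup (load q ω t) : ℕ) : ℝ) - (t : ℝ) / n

/-- `σ` ranks the bins by decreasing load (ties in any order). The rank of bin `i`, counted from
`1`, is `σ i + 1`. -/
def IsRanking {n : ℕ} (x : Fin n → ℕ) (σ : Equiv.Perm (Fin n)) : Prop :=
  ∀ i j, x j < x i → σ i < σ j

/-- An adaptive one-quantile process. The quantile `δ ∈ {1/n, 2/n, …, 1}` of the next step, and
the order in which bins of equal load are ranked, may depend on the whole history. -/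
structure QuantileProcess (n : ℕ) where
  δ : (t : ℕ) → (Fin t → Round n) → ℝ
  δ_mem : ∀ t h, ∃ k : ℕ, 1 ≤ k ∧ k ≤ n ∧ δ t h = (k : ℝ) / n
  rank : (t : ℕ) → (Fin t → Round n) → (Fin n → ℕ) → Equiv.Perm (Fin n)
  isRanking : ∀ t h x, IsRanking x (rank t h x)

/-- A bin is heavy if its rank is at most `δ * n`. -/
def QuantileProcess.query {n : ℕ} (Q : QuantileProcess n) : Query n :=
  fun t h x j => (((Q.rank t h x j : ℕ) + 1 : ℕ) : ℝ) ≤ Q.δ t h * n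

/-- An adaptive one-threshold process: the threshold of the next step may depend on the whole
history. -/
structure ThresholdProcess (n : ℕ) where
  f : (t : ℕ) → (Fin t → Round n) → ℝ

/-- A bin is heavy if its load is at least the threshold. -/
def ThresholdProcess.query {n : ℕ} (F : ThresholdProcess n) : Query n :=
  fun t h x j => F.f t h ≤ (x j : ℝ)

/-- The event that the maximum of the gap over the integers `t ∈ [1, n log² n]` is at least
`(1/8) log n / log log n`. -/
def largeMaxGap {n : ℕ} (q : Query n) : Set (ℕ → Round n) :=
  {ω | ∃ t : ℕ, 1 ≤ t ∧ (t : ℝ) ≤ n * Real.log n ^ 2 ∧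
    1 / 8 * (Real.log n / Real.log (Real.log n)) ≤ gap q ω t}

/-- The event that for some integer `t ∈ [1, n log² n]` the gap is at least
`(1/16) log n / log log n` at all integers `s ∈ [t, t + (1/16) n log n / log log n)`. -/
def largeGapWindow {n : ℕ} (q : Query n) : Set (ℕ → Round n) :=
  {ω | ∃ t : ℕ, 1 ≤ t ∧ (t : ℝ) ≤ n * Real.log n ^ 2 ∧
    ∀ s : ℕ, t ≤ s →
      (s : ℝ) < t + 1 / 16 * (n * (Real.log n / Real.log (Real.log n))) →
      1 / 16 * (Real.log n / Real.log (Real.log n)) ≤ gap q ω s}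

end BallsIntoBins

end

/-!
The theorem holds for every adaptive query, whatever sets of heavy bins it produces, so quantile and
threshold processes need no separate treatment. Put `g = log n / (8 log log n)` and `α = 1 / g`, and
suppose that the gap stays below `g` during `n ⌊log² n⌋` steps. A step is called big if at least
`α n / 48` bins are heavy.

Steps that are not big are almost one-choice steps: a light bin receives the ball with probability
at least `1 / n`, and few bins are heavy. By convexity, such a step increases the potential
`∑ i, exp (α (x i - t / n))` by `Ω(α²)` on average, while the potential is at most `3 n` as long as
the gap is below `g`. An exponential supermartingale then shows that a constant fraction of `α n`
big steps per `n` steps must occur on average, up to an exponentially small probability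
(`measureReal_gap_lt_and_bigCount_le`). Hence one of the windows `[j n, (j + 1) n)` contains more
than `M = ⌊α n / 100⌋` big steps.

In a big step every bin receives the ball with probability at least `α / (48 n)`. At the start of a
window at least `n / (g + 1)` bins have average load or more, because the gap is below `g`. The
product over the bins of the probabilities not to climb `g + O(1)` levels in the remaining big
steps is a supermartingale (`sum_mul_prod_ite_le_prod`), so with overwhelming probability one of
these bins does climb that far (`measureReal_window_le`): the expected number of such bins is
`n ^ (1/2 - o(1))` at least. This contradicts the bound on the gap.

The second claim follows from the first since the maximum load never decreases, so that a gap of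
`2 a` persists as a gap of `a` during the next `a n` steps.
-/

noncomputable section

namespace BallsIntoBins

/-! ### Adapted functions and a supermartingale bound -/

theorem past_eq_past_iff {n : ℕ} {ω ω' : ℕ → Round n} {t : ℕ} :
    past ω t = past ω' t ↔ ∀ i < t, ω i = ω' i :=
  ⟨fun h i hi => congrFun h ⟨i, hi⟩, fun h => funext fun i => h i i.2⟩

theorem past_eq_past_of_le {n : ℕ} {ω ω' : ℕ → Round n} {s t : ℕ} (hst : s ≤ t)
    (h : past ω t = past ω' t) : past ω s = past ω' s :=
  past_eq_past_iff.2 fun i hi => past_eq_past_iff.1 h i (hi.trans_le hst)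

theorem past_update {n : ℕ} (ω : ℕ → Round n) {s t : ℕ} (hst : s ≤ t) (r : Round n) :
    past (Function.update ω t r) s = past ω s :=
  past_eq_past_iff.2 fun _ hi => Function.update_of_ne (hi.trans_le hst).ne _ _

/-- A finite history, continued by an arbitrary constant sequence of rounds. -/
def extend {n : ℕ} [NeZero n] {t : ℕ} (h : Fin t → Round n) : ℕ → Round n :=
  fun i => if hi : i < t then h ⟨i, hi⟩ else (0, 0, true)

theorem past_extend {n : ℕ} [NeZero n] {t : ℕ} (h : Fin t → Round n) : past (extend h) t = h := by
  funext i
  simp [past, extend]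

theorem past_extend_snoc {n : ℕ} [NeZero n] {t : ℕ} (h : Fin t → Round n) (r : Round n) :
    past (extend (Fin.snoc h r : Fin (t + 1) → Round n)) (t + 1) =
      past (Function.update (extend h) t r) (t + 1) := by
  rw [past_extend]
  funext i
  refine Fin.lastCases ?_ (fun i => ?_) i
  · simp [past]
  · simp [past, extend, i.2.ne]

theorem card_round (n : ℕ) : Fintype.card (Round n) = 2 * n ^ 2 := by
  simp [Round, sq]
  ring

instance (n : ℕ) [NeZero n] : IsProbabilityMeasure (roundLaw n) := by
  unfold roundLaw
  infer_instance

theorem roundLaw_past_eq (n : ℕ) [NeZero n] (t : ℕ) (h : Fin t → Round n) :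
    (roundLaw n).real {ω | past ω t = h} = ((2 * (n : ℝ) ^ 2)⁻¹) ^ t := by
  have hset : {ω : ℕ → Round n | past ω t = h} =
      Set.pi (Finset.range t) (fun i => {extend h i}) := by
    ext ω
    rw [Set.mem_ofPred_eq, ← past_extend h, past_eq_past_iff]
    simp [past_extend]
  rw [hset, measureReal_def, roundLaw,
    Measure.infinitePi_pi _ (fun _ _ => MeasurableSet.singleton _),
    ENNReal.toReal_prod]
  have : ∀ i, ((PMF.uniformOfFintype (Round n)).toMeasure {extend h i}).toReal
      = (2 * (n : ℝ) ^ 2)⁻¹ := by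
    intro i
    rw [PMF.toMeasure_apply_singleton _ _ (MeasurableSet.singleton _),
      PMF.uniformOfFintype_apply, card_round]
    simp
  rw [Finset.prod_congr rfl fun i _ => this i, Finset.prod_const, Finset.card_range]

/-- Markov's inequality for a nonnegative adapted process `X` whose conditional expectations do
not increase from time `s` to time `T`. The conditional expectation given the first `t` rounds is
the average over the value of round `t`, and is multiplied out by the number `2 * n ^ 2` of
possible rounds. -/
theorem measureReal_le_of_supermartingale {n : ℕ} [NeZero n] (X : ℕ → (ℕ → Round n) → ℝ)
    {s T : ℕ} (hsT : s ≤ T) {ε : ℝ} (hX : ∀ t ω, 0 ≤ X t ω)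
    (hadapt : ∀ t ω ω', past ω t = past ω' t → X t ω = X t ω')
    (hstep : ∀ t, s ≤ t → t < T → ∀ ω,
      ∑ r, X (t + 1) (Function.update ω t r) ≤ 2 * (n : ℝ) ^ 2 * X t ω)
    (hinit : ∀ ω, X s ω ≤ ε) {A : Set (ℕ → Round n)} (hA : ∀ ω ∈ A, 1 ≤ X T ω) :
    (roundLaw n).real A ≤ ε := by
  classical
  have hn : (0 : ℝ) < 2 * (n : ℝ) ^ 2 := by
    have : (n : ℝ) ≠ 0 := Nat.cast_ne_zero.2 (NeZero.ne n)
    positivity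
  have key : ∀ t, s ≤ t → t ≤ T →
      ∑ h : Fin t → Round n, X t (extend h) ≤ ε * (2 * (n : ℝ) ^ 2) ^ t := by
    intro t hst
    induction t, hst using Nat.le_induction with
    | base =>
      intro _
      calc ∑ h : Fin s → Round n, X s (extend h)
          ≤ ∑ _h : Fin s → Round n, ε := Finset.sum_le_sum fun h _ => hinit _
        _ = ε * (2 * (n : ℝ) ^ 2) ^ s := by
          rw [Finset.sum_const, Finset.card_univ, Fintype.card_fun, card_round, Fintype.card_fin,
            nsmul_eq_mul]
          push_cast
          ring
    | succ t hst ih =>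
      intro htT
      calc ∑ h : Fin (t + 1) → Round n, X (t + 1) (extend h)
          = ∑ h : Fin t → Round n, ∑ r, X (t + 1) (Function.update (extend h) t r) := by
            rw [← (Fin.snocEquiv fun _ => Round n).sum_comp, Fintype.sum_prod_type_right]
            refine Finset.sum_congr rfl fun h _ => Finset.sum_congr rfl fun r _ => ?_
            exact hadapt _ _ _ (past_extend_snoc h r)
        _ ≤ ∑ h : Fin t → Round n, 2 * (n : ℝ) ^ 2 * X t (extend h) :=
            Finset.sum_le_sum fun h _ => hstep t hst htT _
        _ ≤ 2 * (n : ℝ) ^ 2 * (ε * (2 * (n : ℝ) ^ 2) ^ t) := by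
            rw [← Finset.mul_sum]
            exact mul_le_mul_of_nonneg_left (ih (by omega)) hn.le
        _ = ε * (2 * (n : ℝ) ^ 2) ^ (t + 1) := by ring
  set F : Finset (Fin T → Round n) := Finset.univ.filter fun h => 1 ≤ X T (extend h) with hF
  have hsub : A ⊆ ⋃ h ∈ F, {ω | past ω T = h} := by
    intro ω hω
    have : X T (extend (past ω T)) = X T ω := hadapt _ _ _ (past_extend _)
    simp [hF, this, hA ω hω]
  calc (roundLaw n).real A ≤ (roundLaw n).real (⋃ h ∈ F, {ω | past ω T = h}) :=
        measureReal_mono hsub (measure_ne_top _ _)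
    _ ≤ ∑ h ∈ F, (roundLaw n).real {ω | past ω T = h} := measureReal_biUnion_finset_le _ _
    _ = ∑ h ∈ F, ((2 * (n : ℝ) ^ 2)⁻¹) ^ T :=
        Finset.sum_congr rfl fun h _ => roundLaw_past_eq n T h
    _ ≤ ∑ h ∈ F, X T (extend h) * ((2 * (n : ℝ) ^ 2)⁻¹) ^ T := by
        refine Finset.sum_le_sum fun h hh => ?_
        exact le_mul_of_one_le_left (by positivity) (Finset.mem_filter.1 hh).2
    _ ≤ ∑ h : Fin T → Round n, X T (extend h) * ((2 * (n : ℝ) ^ 2)⁻¹) ^ T :=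
        Finset.sum_le_sum_of_subset_of_nonneg (Finset.subset_univ _) fun h _ _ =>
          mul_nonneg (hX _ _) (by positivity)
    _ ≤ ε * (2 * (n : ℝ) ^ 2) ^ T * ((2 * (n : ℝ) ^ 2)⁻¹) ^ T := by
        rw [← Finset.sum_mul]
        exact mul_le_mul_of_nonneg_right (key T hsT le_rfl) (by positivity)
    _ = ε := by
        rw [mul_assoc, ← mul_pow, mul_inv_cancel₀ hn.ne', one_pow, mul_one]

/-! ### One step of the process -/

/-- The set of bins that answer "heavy" to the query put after `t` balls. -/
def heavySet {n : ℕ} (q : Query n) (ω : ℕ → Round n) (t : ℕ) : Set (Fin n) :=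
  {j | q t (past ω t) (load q ω t) j}

theorem load_congr {n : ℕ} (q : Query n) {ω ω' : ℕ → Round n} {t : ℕ}
    (h : past ω t = past ω' t) : load q ω t = load q ω' t := by
  induction t with
  | zero => rfl
  | succ t ih =>
    have h' := past_eq_past_of_le t.le_succ h
    simp only [load, ih h', h', past_eq_past_iff.1 h t t.lt_succ_self]

theorem heavySet_congr {n : ℕ} (q : Query n) {ω ω' : ℕ → Round n} {t : ℕ}
    (h : past ω t = past ω' t) : heavySet q ω t = heavySet q ω' t := by
  simp only [heavySet, load_congr q h, h]

theorem gap_congr {n : ℕ} (q : Query n) {ω ω' : ℕ → Round n} {t : ℕ}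
    (h : past ω t = past ω' t) : gap q ω t = gap q ω' t := by
  simp only [gap, load_congr q h]

theorem load_update_succ {n : ℕ} (q : Query n) (ω : ℕ → Round n) (t : ℕ) (r : Round n) :
    load q (Function.update ω t r) (t + 1) =
      load q ω t + Pi.single (place (· ∈ heavySet q ω t) r) 1 := by
  simp only [load, past_update ω le_rfl, load_congr q (past_update ω le_rfl r),
    Function.update_self]
  rfl

theorem load_mono {n : ℕ} (q : Query n) (ω : ℕ → Round n) : Monotone (load q ω) :=
  monotone_nat_of_le_succ fun t => by
    simp only [load]
    exact le_self_add

theorem sum_load {n : ℕ} (q : Query n) (ω : ℕ → Round n) (t : ℕ) :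
    ∑ i, load q ω t i = t := by
  induction t with
  | zero => simp [load]
  | succ t ih => simp [load, Finset.sum_add_distrib, ih]

theorem load_le_gap_add {n : ℕ} (q : Query n) (ω : ℕ → Round n) (t : ℕ) (i : Fin n) :
    (load q ω t i : ℝ) ≤ gap q ω t + (t : ℝ) / n := by
  rw [gap, sub_add_cancel]
  exact_mod_cast Finset.le_sup (f := load q ω t) (Finset.mem_univ i)

/-- Among the `2 * n ^ 2` possible rounds, at least `2 * n` put the ball into a given light bin
and at least `2 * n * (h / n)` into a given bin of any kind, where `h` is the number of heavy
bins: if the coin selects bin `i`, the ball can only be diverted when `i` is heavy and the other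
bin is light. -/
theorem card_place_eq_ge {n : ℕ} (H : Set (Fin n)) (i : Fin n) :
    2 * H.ncard ≤ Nat.card {r : Round n // place (· ∈ H) r = i} ∧
      (i ∉ H → 2 * n ≤ Nat.card {r : Round n // place (· ∈ H) r = i}) := by
  classical
  have hinj : ∀ S : Set (Fin n), (∀ b ∈ S, i ∈ H → b ∈ H) →
      2 * S.ncard ≤ Nat.card {r : Round n // place (· ∈ H) r = i} := by
    intro S hS
    have : 2 * S.ncard = Nat.card (S × Bool) := by
      rw [Nat.card_prod, Nat.card_coe_set_eq, Nat.card_eq_fintype_card (α := Bool)]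
      simp [mul_comm]
    rw [this]
    refine Nat.card_le_card_of_injective (fun x => ⟨if x.2 then (i, x.1.1, true)
      else (x.1.1, i, false), ?_⟩) ?_
    · have := hS x.1.1 x.1.2
      rcases x with ⟨⟨b, hb⟩, c⟩
      cases c <;> simp only [place] <;> by_cases hi : i ∈ H <;> by_cases hb' : b ∈ H <;>
        simp_all
    · rintro ⟨⟨b, hb⟩, c⟩ ⟨⟨b', hb'⟩, c'⟩ h
      cases c <;> cases c' <;> simp_all
  refine ⟨hinj H fun b hb _ => hb, fun hi => ?_⟩
  simpa using hinj Set.univ fun b _ h => absurd h hi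

/-- The probability that a uniformly random round puts the ball into bin `i` when `H` is the set
of heavy bins. -/
def placeProb {n : ℕ} (H : Set (Fin n)) (i : Fin n) : ℝ :=
  Nat.card {r : Round n // place (· ∈ H) r = i} / (2 * (n : ℝ) ^ 2)

theorem placeProb_nonneg {n : ℕ} (H : Set (Fin n)) (i : Fin n) : 0 ≤ placeProb H i := by
  unfold placeProb
  positivity

theorem sum_place {n : ℕ} [NeZero n] (H : Set (Fin n)) (f : Fin n → ℝ) :
    ∑ r : Round n, f (place (· ∈ H) r) = 2 * (n : ℝ) ^ 2 * ∑ i, placeProb H i * f i := by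
  classical
  have hn : (n : ℝ) ≠ 0 := Nat.cast_ne_zero.2 (NeZero.ne n)
  rw [← Finset.sum_fiberwise_of_maps_to (g := place (· ∈ H)) (t := Finset.univ)
    (fun _ _ => Finset.mem_univ _), Finset.mul_sum]
  refine Finset.sum_congr rfl fun i _ => ?_
  rw [Finset.sum_congr rfl (g := fun _ => f i) fun r hr => by rw [(Finset.mem_filter.1 hr).2],
    Finset.sum_const, nsmul_eq_mul, placeProb, Nat.card_eq_fintype_card, Fintype.card_subtype]
  field_simp

theorem sum_placeProb {n : ℕ} [NeZero n] (H : Set (Fin n)) : ∑ i, placeProb H i = 1 := by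
  have hn : (n : ℝ) ≠ 0 := Nat.cast_ne_zero.2 (NeZero.ne n)
  have h := sum_place H fun _ => 1
  simp only [Finset.sum_const, Finset.card_univ, card_round, nsmul_eq_mul, mul_one] at h
  push_cast at h
  have h2 : (2 * (n : ℝ) ^ 2) ≠ 0 := by positivity
  exact (mul_left_cancel₀ h2 (by rw [mul_one]; exact h)).symm

theorem ncard_div_le_placeProb {n : ℕ} [NeZero n] (H : Set (Fin n)) (i : Fin n) :
    (H.ncard : ℝ) / n ^ 2 ≤ placeProb H i := by
  have h : ((2 * H.ncard : ℕ) : ℝ) ≤ Nat.card {r : Round n // place (· ∈ H) r = i} :=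
    Nat.cast_le.2 (card_place_eq_ge H i).1
  have hn : (n : ℝ) ≠ 0 := Nat.cast_ne_zero.2 (NeZero.ne n)
  rw [placeProb, ← mul_div_mul_left (H.ncard : ℝ) ((n : ℝ) ^ 2) two_ne_zero]
  push_cast at h
  gcongr

theorem one_div_le_placeProb {n : ℕ} [NeZero n] (H : Set (Fin n)) {i : Fin n} (hi : i ∉ H) :
    1 / (n : ℝ) ≤ placeProb H i := by
  have h : ((2 * n : ℕ) : ℝ) ≤ Nat.card {r : Round n // place (· ∈ H) r = i} :=
    Nat.cast_le.2 ((card_place_eq_ge H i).2 hi)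
  have hn : (n : ℝ) ≠ 0 := Nat.cast_ne_zero.2 (NeZero.ne n)
  have : 1 / (n : ℝ) = (2 * n : ℝ) / (2 * (n : ℝ) ^ 2) := by field_simp
  rw [placeProb, this]
  push_cast at h
  gcongr

/-! ### The exponential potential -/

/-- The exponential potential `∑ i, exp (α * (x i - t / n))` of the load vector `x` after `t`
balls. -/
def potential {n : ℕ} (α : ℝ) (q : Query n) (ω : ℕ → Round n) (t : ℕ) : ℝ :=
  ∑ i, Real.exp (α * (load q ω t i - (t : ℝ) / n))

open Classical in
/-- The number of steps in `[s, t)` whose query has at least `D` heavy bins. -/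
def bigCount {n : ℕ} (D : ℝ) (q : Query n) (ω : ℕ → Round n) (s t : ℕ) : ℕ :=
  ((Finset.Ico s t).filter fun u => D ≤ (heavySet q ω u).ncard).card

theorem bigCount_congr {n : ℕ} (D : ℝ) (q : Query n) {ω ω' : ℕ → Round n} (s : ℕ) {t : ℕ}
    (h : past ω t = past ω' t) : bigCount D q ω s t = bigCount D q ω' s t := by
  classical
  unfold bigCount
  congr 1
  refine Finset.filter_congr fun u hu => ?_
  rw [heavySet_congr q (past_eq_past_of_le (Finset.mem_Ico.1 hu).2.le h)]

open Classical in
theorem bigCount_succ {n : ℕ} (D : ℝ) (q : Query n) (ω : ℕ → Round n) {s t : ℕ} (hst : s ≤ t) :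
    bigCount D q ω s (t + 1) =
      bigCount D q ω s t + if D ≤ (heavySet q ω t).ncard then 1 else 0 := by
  unfold bigCount
  rw [← Finset.insert_Ico_right_eq_Ico_add_one hst, Finset.filter_insert]
  split_ifs
  · rw [Finset.card_insert_of_notMem (by simp)]
  · simp

theorem bigCount_self {n : ℕ} (D : ℝ) (q : Query n) (ω : ℕ → Round n) (s : ℕ) :
    bigCount D q ω s s = 0 := by
  simp [bigCount]

theorem bigCount_add {n : ℕ} (D : ℝ) (q : Query n) (ω : ℕ → Round n) {s t u : ℕ} (hst : s ≤ t)
    (htu : t ≤ u) : bigCount D q ω s u = bigCount D q ω s t + bigCount D q ω t u := by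
  induction u, htu using Nat.le_induction with
  | base => simp [bigCount_self]
  | succ u htu ih =>
    rw [bigCount_succ D q ω (hst.trans htu), bigCount_succ D q ω htu, ih, add_assoc]

theorem exp_sub_one_le_two_mul {α : ℝ} (h0 : 0 ≤ α) (h1 : α ≤ 1) : Real.exp α - 1 ≤ 2 * α := by
  have h := (abs_le.1 (Real.abs_exp_sub_one_sub_id_le (x := α) (by rwa [abs_of_nonneg h0]))).2
  nlinarith

/-- If a quantity changes by `Δ i` with probability `p i`, the changes are of order `α`, and
their mean is at least `α ^ 2 / 8`, then the exponential moment with the small constant rate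
`1 / 576` contracts. -/
theorem sum_mul_exp_neg_le {ι : Type*} [Fintype ι] {p Δ : ι → ℝ} {α : ℝ}
    (h1 : α ≤ 1) (hp : ∀ i, 0 ≤ p i) (hp1 : ∑ i, p i = 1) (hΔ : ∀ i, |Δ i| ≤ 6 * α)
    (hmean : α ^ 2 / 8 ≤ ∑ i, p i * Δ i) :
    ∑ i, p i * Real.exp (-(1 / 576 * Δ i)) ≤ Real.exp (-(1 / 576 * (α ^ 2 / 16))) := by
  have hexp : ∀ i, Real.exp (-(1 / 576 * Δ i)) ≤ 1 - 1 / 576 * Δ i + 1 / 576 * (α ^ 2 / 16) := by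
    intro i
    have hx : |-(1 / 576 * Δ i)| ≤ 1 := by
      rw [abs_neg, abs_mul, abs_of_pos (by norm_num : (0 : ℝ) < 1 / 576)]
      linarith [hΔ i]
    have h := (abs_le.1 (Real.abs_exp_sub_one_sub_id_le hx)).2
    have h2 : Δ i ^ 2 ≤ (6 * α) ^ 2 := sq_le_sq' (abs_le.1 (hΔ i)).1 (abs_le.1 (hΔ i)).2
    nlinarith
  calc ∑ i, p i * Real.exp (-(1 / 576 * Δ i))
      ≤ ∑ i, p i * (1 - 1 / 576 * Δ i + 1 / 576 * (α ^ 2 / 16)) :=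
        Finset.sum_le_sum fun i _ => mul_le_mul_of_nonneg_left (hexp i) (hp i)
    _ = ∑ i, p i - 1 / 576 * ∑ i, p i * Δ i + (∑ i, p i) * (1 / 576 * (α ^ 2 / 16)) := by
        rw [Finset.mul_sum, Finset.sum_mul, ← Finset.sum_sub_distrib, ← Finset.sum_add_distrib]
        exact Finset.sum_congr rfl fun i _ => by ring
    _ ≤ -(1 / 576 * (α ^ 2 / 16)) + 1 := by
        rw [hp1]
        linarith
    _ ≤ _ := Real.add_one_le_exp _

section Step

variable {n : ℕ} {α : ℝ} {y : Fin n → ℝ}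

theorem card_le_sum_exp (hsum : ∑ i, y i = 0) : (n : ℝ) ≤ ∑ i, Real.exp (α * y i) := by
  calc (n : ℝ) = ∑ i, (α * y i + 1) := by
        rw [Finset.sum_add_distrib, ← Finset.mul_sum, hsum]
        simp
    _ ≤ _ := Finset.sum_le_sum fun i _ => Real.add_one_le_exp _

theorem sum_exp_le (hy : ∀ i, α * y i ≤ 1) : ∑ i, Real.exp (α * y i) ≤ 3 * n := by
  calc ∑ i, Real.exp (α * y i) ≤ ∑ _i : Fin n, (3 : ℝ) :=
        Finset.sum_le_sum fun i _ =>
          (Real.exp_le_exp.2 (hy i)).trans (Real.exp_one_lt_d9.le.trans (by norm_num))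
    _ = 3 * n := by simp [mul_comm]

/-- The change of the potential when bin `a` receives the ball: all normalized loads decrease by
`1 / n`, and that of `a` increases by `1`. -/
theorem abs_potential_change_le [NeZero n] (h0 : 0 ≤ α) (h1 : α ≤ 1) (hy : ∀ i, α * y i ≤ 1)
    (a : Fin n) :
    -(3 * α) ≤ Real.exp (-(α / n)) *
        (∑ i, Real.exp (α * y i) + (Real.exp α - 1) * Real.exp (α * y a)) -
        ∑ i, Real.exp (α * y i) ∧
      |Real.exp (-(α / n)) *
        (∑ i, Real.exp (α * y i) + (Real.exp α - 1) * Real.exp (α * y a)) -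
        ∑ i, Real.exp (α * y i)| ≤ 6 * α := by
  have hn : (1 : ℝ) ≤ n := by exact_mod_cast NeZero.one_le
  set Ψ := ∑ i, Real.exp (α * y i) with hΨ
  have hΨ3 : Ψ ≤ 3 * n := sum_exp_le hy
  have hΨ0 : 0 ≤ Ψ := Finset.sum_nonneg fun i _ => (Real.exp_pos _).le
  have hA0 := (Real.exp_pos (α * y a)).le
  have hA3 : Real.exp (α * y a) ≤ 3 :=
    (Real.exp_le_exp.2 (hy a)).trans (Real.exp_one_lt_d9.le.trans (by norm_num))
  have hE0 : 0 ≤ Real.exp α - 1 := by linarith [Real.add_one_le_exp α]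
  have hE2 := exp_sub_one_le_two_mul h0 h1
  have hG0 : 0 ≤ (Real.exp α - 1) * Real.exp (α * y a) := mul_nonneg hE0 hA0
  have hG6 : (Real.exp α - 1) * Real.exp (α * y a) ≤ 6 * α := by
    calc _ ≤ 2 * α * 3 := mul_le_mul hE2 hA3 hA0 (by linarith)
      _ = 6 * α := by ring
  have hc1 : Real.exp (-(α / n)) ≤ 1 := Real.exp_le_one_iff.2 (by
    have : 0 ≤ α / n := by positivity
    linarith)
  have hc2 : 1 - α / n ≤ Real.exp (-(α / n)) := by linarith [Real.add_one_le_exp (-(α / n))]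
  have hlow : -(3 * α) ≤ Real.exp (-(α / n)) *
      (Ψ + (Real.exp α - 1) * Real.exp (α * y a)) - Ψ := by
    have h3 : α / n * Ψ ≤ 3 * α := by
      rw [div_mul_eq_mul_div, div_le_iff₀ (by linarith)]
      nlinarith
    have h4 : (1 - α / n) * Ψ ≤ Real.exp (-(α / n)) * Ψ := mul_le_mul_of_nonneg_right hc2 hΨ0
    have h5 := mul_nonneg (Real.exp_pos (-(α / n))).le hG0
    nlinarith
  refine ⟨hlow, abs_le.2 ⟨by linarith, ?_⟩⟩
  have := mul_le_mul_of_nonneg_right hc1 (add_nonneg hΨ0 hG0)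
  linarith

/-- When few bins are heavy, the ball is placed almost as in the one-choice process, so the
potential increases by `Ω(α ^ 2)` on average, by convexity of the exponential function. -/
theorem potential_drift [NeZero n] (hn : 6 ≤ n) (h0 : 0 ≤ α) (h1 : α ≤ 1) (hy : ∀ i, α * y i ≤ 1)
    (hsum : ∑ i, y i = 0) {H : Set (Fin n)} (hH : (H.ncard : ℝ) ≤ α * n / 48) :
    α ^ 2 / 8 ≤ ∑ a, placeProb H a * (Real.exp (-(α / n)) *
        (∑ i, Real.exp (α * y i) + (Real.exp α - 1) * Real.exp (α * y a)) -
        ∑ i, Real.exp (α * y i)) := by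
  classical
  have hn6 : (6 : ℝ) ≤ n := by exact_mod_cast hn
  have hn0 : (0 : ℝ) < n := by linarith
  set Ψ := ∑ i, Real.exp (α * y i) with hΨ
  set P := ∑ a, placeProb H a * Real.exp (α * y a) with hP
  have hΨ3 : Ψ ≤ 3 * n := sum_exp_le hy
  have hΨ1 : (n : ℝ) ≤ Ψ := card_le_sum_exp hsum
  have hPΨ : Ψ / n - α / 16 ≤ P := by
    have hcard : (H.ncard : ℝ) = ∑ i, if i ∈ H then (1 : ℝ) else 0 := by
      rw [Set.ncard_eq_toFinset_card', Finset.sum_boole]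
      congr 2
      ext
      simp
    have hterm : ∀ a, Real.exp (α * y a) / n - 3 / n * (if a ∈ H then (1 : ℝ) else 0) ≤
        placeProb H a * Real.exp (α * y a) := by
      intro a
      have hA0 := (Real.exp_pos (α * y a)).le
      have hA3 : Real.exp (α * y a) ≤ 3 :=
        (Real.exp_le_exp.2 (hy a)).trans (Real.exp_one_lt_d9.le.trans (by norm_num))
      split_ifs with ha
      · have h2 := mul_nonneg (placeProb_nonneg H a) hA0
        have h3 : Real.exp (α * y a) / n ≤ 3 / n := by gcongr
        linarith
      · rw [mul_zero, sub_zero, div_eq_mul_one_div, mul_comm]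
        exact mul_le_mul_of_nonneg_right (one_div_le_placeProb H ha) hA0
    have h2 : Ψ / n - 3 / n * H.ncard ≤ P := by
      rw [hcard, hΨ, Finset.sum_div, Finset.mul_sum, ← Finset.sum_sub_distrib]
      exact Finset.sum_le_sum fun a _ => hterm a
    have h3 : 3 / (n : ℝ) * H.ncard ≤ α / 16 := by
      calc 3 / (n : ℝ) * H.ncard ≤ 3 / (n : ℝ) * (α * n / 48) := by gcongr
        _ = α / 16 := by
          field_simp
          ring
    linarith
  have hsumeq : ∑ a, placeProb H a * (Real.exp (-(α / n)) *
      (Ψ + (Real.exp α - 1) * Real.exp (α * y a)) - Ψ) =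
      Real.exp (-(α / n)) * (Ψ + (Real.exp α - 1) * P) - Ψ := by
    have : ∀ a, placeProb H a * (Real.exp (-(α / n)) *
        (Ψ + (Real.exp α - 1) * Real.exp (α * y a)) - Ψ) =
        (Real.exp (-(α / n)) * Ψ - Ψ) * placeProb H a +
          Real.exp (-(α / n)) * (Real.exp α - 1) * (placeProb H a * Real.exp (α * y a)) := by
      intro a
      ring
    rw [Finset.sum_congr rfl fun a _ => this a, Finset.sum_add_distrib, ← Finset.mul_sum,
      ← Finset.mul_sum, sum_placeProb, ← hP]
    ring
  rw [hsumeq]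
  have hE1 : α + α ^ 2 / 2 ≤ Real.exp α - 1 := by
    linarith [Real.quadratic_le_exp_of_nonneg h0]
  have hE2 := exp_sub_one_le_two_mul h0 h1
  have hc2 : 1 - α / n ≤ Real.exp (-(α / n)) := by linarith [Real.add_one_le_exp (-(α / n))]
  set R := Ψ / n with hR
  have hR1 : 1 ≤ R := by
    rw [hR, le_div_iff₀ hn0]
    linarith
  have hmain : (α + α ^ 2 / 2) * R - α ^ 2 / 8 ≤ (Real.exp α - 1) * P := by
    calc (α + α ^ 2 / 2) * R - α ^ 2 / 8 ≤ (Real.exp α - 1) * R - (Real.exp α - 1) * (α / 16) := by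
          nlinarith
      _ = (Real.exp α - 1) * (R - α / 16) := by ring
      _ ≤ _ := mul_le_mul_of_nonneg_left hPΨ (by nlinarith)
  have hpos : 0 ≤ (α + α ^ 2 / 2) * R - α ^ 2 / 8 := by nlinarith
  have hstep : (1 - α / n) * (Ψ + ((α + α ^ 2 / 2) * R - α ^ 2 / 8)) ≤
      Real.exp (-(α / n)) * (Ψ + (Real.exp α - 1) * P) :=
    mul_le_mul hc2 (by linarith) (by linarith) (Real.exp_pos _).le
  have hsmall : α / n * ((α + α ^ 2 / 2) * R - α ^ 2 / 8) ≤ α ^ 2 / 4 * R := by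
    rw [div_mul_eq_mul_div, div_le_iff₀ hn0]
    have h2 : (α + α ^ 2 / 2) * R - α ^ 2 / 8 ≤ 3 / 2 * α * R := by nlinarith
    calc α * ((α + α ^ 2 / 2) * R - α ^ 2 / 8) ≤ α * (3 / 2 * α * R) :=
          mul_le_mul_of_nonneg_left h2 h0
      _ = α ^ 2 / 4 * R * 6 := by ring
      _ ≤ α ^ 2 / 4 * R * n := mul_le_mul_of_nonneg_left hn6
          (mul_nonneg (by positivity) (by linarith))
  have hαΨ : α / n * Ψ = α * R := by
    rw [hR]
    ring
  have hnR : Ψ + ((α + α ^ 2 / 2) * R - α ^ 2 / 8) - α / n * Ψ -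
      α / n * ((α + α ^ 2 / 2) * R - α ^ 2 / 8) =
      (1 - α / n) * (Ψ + ((α + α ^ 2 / 2) * R - α ^ 2 / 8)) := by ring
  nlinarith

end Step

/-- It is unlikely that the gap stays below `1 / α` up to time `T` while at most `b` of the queries
have `α * n / 48` or more heavy bins, if `α ^ 2 * T` is large compared with `n` and `α * b`: the
potential, which cannot exceed `3 * n`, would have grown too much. -/
theorem measureReal_gap_lt_and_bigCount_le {n : ℕ} [NeZero n] (hn : 6 ≤ n) {α : ℝ} (h0 : 0 < α)
    (h1 : α ≤ 1) (q : Query n) (T : ℕ) (b : ℝ) :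
    (roundLaw n).real {ω | (∀ s ≤ T, gap q ω s < 1 / α) ∧
        (bigCount (α * n / 48) q ω 0 T : ℝ) ≤ b} ≤
      Real.exp (1 / 576 * (2 * n - α ^ 2 / 16 * (T - b) + 3 * α * b)) := by
  classical
  have hn0 : (n : ℝ) ≠ 0 := Nat.cast_ne_zero.2 (NeZero.ne n)
  set D : ℝ := α * n / 48 with hD
  set C : ℝ := α ^ 2 / 16 * (T - b) - 3 * α * b - 3 * n with hC
  -- Small steps increase the potential by `α ^ 2 / 8` on average, of which the second-order term
  -- takes one half; big steps decrease it by at most `3 * α`. The constant `C` makes `X` at least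
  -- `1` on the event at time `T`.
  set X : ℕ → (ℕ → Round n) → ℝ := fun t ω =>
    if ∀ s ≤ t, gap q ω s < 1 / α then
      Real.exp (1 / 576 * (-potential α q ω t + α ^ 2 / 16 * (t - bigCount D q ω 0 t) -
        3 * α * bigCount D q ω 0 t - C))
    else 0 with hX
  have hgap : ∀ {ω t}, gap q ω t < 1 / α → ∀ i, α * (load q ω t i - (t : ℝ) / n) ≤ 1 := by
    intro ω t h i
    rw [lt_div_iff₀ h0] at h
    have := load_le_gap_add q ω t i
    nlinarith
  have hbound : (1 / 576 * (2 * n - α ^ 2 / 16 * (T - b) + 3 * α * b) : ℝ) =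
      1 / 576 * (-(n : ℝ) - C) := by
    rw [hC]
    ring
  rw [hbound]
  refine measureReal_le_of_supermartingale X (Nat.zero_le T) ?_ ?_ ?_ ?_ ?_
  · intro t ω
    simp only [hX]
    split_ifs
    · exact (Real.exp_pos _).le
    · exact le_rfl
  · intro t ω ω' h
    have hg : (∀ s ≤ t, gap q ω s < 1 / α) ↔ ∀ s ≤ t, gap q ω' s < 1 / α :=
      forall₂_congr fun s hs => by rw [gap_congr q (past_eq_past_of_le hs h)]
    simp only [hX, hg, potential, load_congr q h, bigCount_congr D q 0 h]
  · intro t _ _ ω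
    by_cases hlt : ∀ s ≤ t, gap q ω s < 1 / α
    swap
    · have hzero : ∀ r, X (t + 1) (Function.update ω t r) = 0 := by
        intro r
        refine if_neg fun h => hlt fun s hs => ?_
        rw [← gap_congr q (past_update ω hs r)]
        exact h s (hs.trans t.le_succ)
      rw [Finset.sum_eq_zero fun r _ => hzero r, show X t ω = 0 from if_neg hlt, mul_zero]
    set H := heavySet q ω t with hH
    set y : Fin n → ℝ := fun i => load q ω t i - (t : ℝ) / n with hy
    set Ψ : ℝ := ∑ i, Real.exp (α * y i) with hΨ
    have hy1 : ∀ i, α * y i ≤ 1 := hgap (hlt t le_rfl)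
    have hy0 : ∑ i, y i = 0 := by
      have := sum_load q ω t
      simp only [hy, Finset.sum_sub_distrib, Finset.sum_const, Finset.card_univ, Fintype.card_fin,
        nsmul_eq_mul]
      rw [← Nat.cast_sum, this]
      field_simp
      ring
    set Δ : Fin n → ℝ := fun a =>
      Real.exp (-(α / n)) * (Ψ + (Real.exp α - 1) * Real.exp (α * y a)) - Ψ with hΔ
    have hpot : ∀ r, potential α q (Function.update ω t r) (t + 1) =
        Ψ + Δ (place (· ∈ H) r) := by
      intro r
      set a := place (· ∈ H) r with ha
      have : ∀ i, Real.exp (α * (load q (Function.update ω t r) (t + 1) i - ((t + 1 : ℕ) : ℝ) / n))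
          = Real.exp (-(α / n)) * (Real.exp (α * y i) +
            if i = a then (Real.exp α - 1) * Real.exp (α * y a) else 0) := by
        intro i
        rw [load_update_succ, ← hH, ← ha]
        split_ifs with hi
        · subst hi
          rw [← one_add_mul, add_sub_cancel, ← Real.exp_add, ← Real.exp_add]
          congr 1
          simp only [hy, Pi.add_apply, Pi.single_eq_same]
          push_cast
          field_simp
          ring
        · rw [add_zero, ← Real.exp_add]
          congr 1
          simp only [hy, Pi.add_apply, Pi.single_eq_of_ne hi]
          push_cast
          field_simp
          ring
      rw [potential, Finset.sum_congr rfl fun i _ => this i, ← Finset.mul_sum,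
        Finset.sum_add_distrib, Finset.sum_ite_eq' Finset.univ a, if_pos (Finset.mem_univ a)]
      simp only [hΔ]
      ring
    set big : Prop := D ≤ H.ncard with hbig
    have hcount : ∀ r, bigCount D q (Function.update ω t r) 0 (t + 1) =
        bigCount D q ω 0 t + if big then 1 else 0 := by
      intro r
      rw [bigCount_succ D q _ t.zero_le, bigCount_congr D q 0 (past_update ω le_rfl r),
        heavySet_congr q (past_update ω le_rfl r)]
    have hone : ∑ a, placeProb H a * Real.exp (-(1 / 576 * Δ a)) ≤
        Real.exp (-(1 / 576 * (if big then -(3 * α) else α ^ 2 / 16))) := by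
      split_ifs with hb
      · calc ∑ a, placeProb H a * Real.exp (-(1 / 576 * Δ a))
            ≤ ∑ a, placeProb H a * Real.exp (-(1 / 576 * -(3 * α))) := by
              refine Finset.sum_le_sum fun a _ =>
                mul_le_mul_of_nonneg_left (Real.exp_le_exp.2 ?_) (placeProb_nonneg H a)
              linarith [(abs_potential_change_le h0.le h1 hy1 a).1]
          _ = _ := by rw [← Finset.sum_mul, sum_placeProb, one_mul]
      · exact sum_mul_exp_neg_le h1 (placeProb_nonneg H) (sum_placeProb H)
          (fun a => (abs_potential_change_le h0.le h1 hy1 a).2)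
          (potential_drift hn h0.le h1 hy1 hy0 (not_le.1 hb).le)
    set K : ℝ := 1 / 576 * (-Ψ + α ^ 2 / 16 * (t - bigCount D q ω 0 t) -
        3 * α * bigCount D q ω 0 t - C) with hK
    have hXt : X t ω = Real.exp K := if_pos hlt
    -- `e` is the lower bound for the effective increase of the potential in this step.
    set e : ℝ := if big then -(3 * α) else α ^ 2 / 16 with he
    have hXr : ∀ r, X (t + 1) (Function.update ω t r) ≤
        Real.exp (K + 1 / 576 * e) * Real.exp (-(1 / 576 * Δ (place (· ∈ H) r))) := by
      intro r
      simp only [hX]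
      split_ifs
      · rw [← Real.exp_add, Real.exp_le_exp, hpot, hcount, hK, he]
        refine le_of_eq ?_
        split_ifs <;> push_cast <;> ring
      · positivity
    calc ∑ r, X (t + 1) (Function.update ω t r)
        ≤ ∑ r, Real.exp (K + 1 / 576 * e) * Real.exp (-(1 / 576 * Δ (place (· ∈ H) r))) :=
          Finset.sum_le_sum fun r _ => hXr r
      _ = 2 * (n : ℝ) ^ 2 * (Real.exp (K + 1 / 576 * e) *
            ∑ a, placeProb H a * Real.exp (-(1 / 576 * Δ a))) := by
          rw [← Finset.mul_sum, sum_place H fun a => Real.exp (-(1 / 576 * Δ a))]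
          ring
      _ ≤ 2 * (n : ℝ) ^ 2 * (Real.exp (K + 1 / 576 * e) * Real.exp (-(1 / 576 * e))) := by
          gcongr
      _ = 2 * (n : ℝ) ^ 2 * X t ω := by
          rw [hXt, ← Real.exp_add]
          congr 3
          ring
  · intro ω
    simp only [hX]
    split_ifs
    · refine Real.exp_le_exp.2 (le_of_eq ?_)
      simp [potential, load, bigCount_self]
    · exact (Real.exp_pos _).le
  · rintro ω ⟨hlt, hB⟩
    simp only [hX]
    rw [if_pos hlt, Real.one_le_exp_iff]
    have hpot : potential α q ω T ≤ 3 * n := sum_exp_le (hgap (hlt T le_rfl))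
    have h2 : α ^ 2 / 16 * bigCount D q ω 0 T ≤ α ^ 2 / 16 * b := by gcongr
    have h3 : 3 * α * bigCount D q ω 0 T ≤ 3 * α * b := by gcongr
    rw [hC]
    nlinarith

/-! ### Windows with many large heavy sets -/

/-- `binomialTail ρ j s` is the probability of at least `j` successes in `s` independent trials
with success probability `ρ`. -/
def binomialTail (ρ : ℝ) : ℕ → ℕ → ℝ
  | 0, _ => 1
  | _ + 1, 0 => 0
  | j + 1, s + 1 => (1 - ρ) * binomialTail ρ (j + 1) s + ρ * binomialTail ρ j s

section BinomialTail

variable {ρ : ℝ}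

theorem binomialTail_succ_right (ρ : ℝ) (j s : ℕ) : binomialTail ρ j (s + 1) =
    (1 - ρ) * binomialTail ρ j s + ρ * binomialTail ρ (j - 1) s := by
  cases j <;> simp [binomialTail]

theorem binomialTail_nonneg (h0 : 0 ≤ ρ) (h1 : ρ ≤ 1) (j s : ℕ) : 0 ≤ binomialTail ρ j s := by
  induction s generalizing j with
  | zero => cases j <;> simp [binomialTail]
  | succ s ih =>
    rw [binomialTail_succ_right]
    exact add_nonneg (mul_nonneg (sub_nonneg.2 h1) (ih _)) (mul_nonneg h0 (ih _))

theorem binomialTail_antitone_left (h0 : 0 ≤ ρ) (h1 : ρ ≤ 1) (s : ℕ) :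
    Antitone fun j => binomialTail ρ j s := by
  refine antitone_nat_of_succ_le fun j => ?_
  induction s generalizing j with
  | zero => cases j <;> simp [binomialTail]
  | succ s ih =>
    have h3 : binomialTail ρ (j + 1 - 1) s ≤ binomialTail ρ (j - 1) s :=
      antitone_nat_of_succ_le (f := fun j => binomialTail ρ j s) ih (by omega)
    rw [binomialTail_succ_right, binomialTail_succ_right ρ j]
    exact add_le_add (mul_le_mul_of_nonneg_left (ih j) (sub_nonneg.2 h1))
      (mul_le_mul_of_nonneg_left h3 h0)

theorem binomialTail_le_one (h0 : 0 ≤ ρ) (h1 : ρ ≤ 1) (j s : ℕ) : binomialTail ρ j s ≤ 1 := by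
  simpa [binomialTail] using binomialTail_antitone_left h0 h1 s (Nat.zero_le j)

theorem choose_mul_pow_le_binomialTail (h0 : 0 ≤ ρ) (h1 : ρ ≤ 1) (j s : ℕ) :
    (s.choose j : ℝ) * ρ ^ j * (1 - ρ) ^ s ≤ binomialTail ρ j s := by
  have h2 : 0 ≤ 1 - ρ := sub_nonneg.2 h1
  induction s generalizing j with
  | zero => cases j <;> simp [binomialTail]
  | succ s ih =>
    cases j with
    | zero => simpa [binomialTail] using pow_le_one₀ h2 (by linarith)
    | succ j =>
      have ha := mul_le_mul_of_nonneg_left (ih (j + 1)) h2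
      have hb := mul_le_mul_of_nonneg_left (ih j) h0
      have hc : (s.choose j : ℝ) * ρ ^ (j + 1) * (1 - ρ) ^ (s + 1) ≤
          ρ * (s.choose j * ρ ^ j * (1 - ρ) ^ s) := by
        rw [pow_succ (1 - ρ), pow_succ ρ]
        have : 0 ≤ ρ * (s.choose j * ρ ^ j * (1 - ρ) ^ s) := by positivity
        nlinarith
      calc ((s + 1).choose (j + 1) : ℝ) * ρ ^ (j + 1) * (1 - ρ) ^ (s + 1)
          = (1 - ρ) * (s.choose (j + 1) * ρ ^ (j + 1) * (1 - ρ) ^ s) +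
            s.choose j * ρ ^ (j + 1) * (1 - ρ) ^ (s + 1) := by
            rw [Nat.choose_succ_succ]
            push_cast
            ring
        _ ≤ _ := by
          rw [binomialTail]
          linarith

end BinomialTail

/-- Lowering the factors one at a time, to first order in `ρ`, costs at least as much as lowering
all of them: a form of Weierstrass' product inequality that allows zero factors. -/
theorem prod_sub_sum_le_prod {ι : Type*} [DecidableEq ι] (s : Finset ι) {u v : ι → ℝ} {ρ : ℝ}
    (h0 : 0 ≤ ρ) (h1 : ρ ≤ 1) (hu : ∀ i, 0 ≤ u i) (huv : ∀ i, u i ≤ v i) :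
    ∏ i ∈ s, v i - ρ * ∑ a ∈ s, (∏ i ∈ s, v i - ∏ i ∈ s, if i = a then u i else v i) ≤
      ∏ i ∈ s, ((1 - ρ) * v i + ρ * u i) := by
  have hv : ∀ i, 0 ≤ v i := fun i => (hu i).trans (huv i)
  induction s using Finset.induction_on with
  | empty => simp
  | insert b s hb ih =>
    set P := ∏ i ∈ s, v i with hP
    set S := ∑ a ∈ s, (P - ∏ i ∈ s, if i = a then u i else v i) with hS
    have hP0 : 0 ≤ P := Finset.prod_nonneg fun i _ => hv i
    have hS0 : 0 ≤ S := Finset.sum_nonneg fun a _ => sub_nonneg.2 <|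
      Finset.prod_le_prod (fun i _ => by split_ifs <;> simp [hu, hv]) fun i _ => by
        split_ifs <;> simp [huv]
    have hsum : ∑ a ∈ insert b s, (∏ i ∈ insert b s, v i -
        ∏ i ∈ insert b s, if i = a then u i else v i) = (v b - u b) * P + v b * S := by
      rw [Finset.sum_insert hb, hS, Finset.mul_sum]
      congr 1
      · rw [Finset.prod_insert hb, Finset.prod_insert hb, if_pos rfl,
          Finset.prod_congr rfl fun i hi => if_neg (ne_of_mem_of_not_mem hi hb)]
        ring
      · refine Finset.sum_congr rfl fun a ha => ?_
        rw [Finset.prod_insert hb, Finset.prod_insert hb,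
          if_neg (ne_of_mem_of_not_mem ha hb).symm]
        ring
    have hw : 0 ≤ (1 - ρ) * v b + ρ * u b :=
      add_nonneg (mul_nonneg (sub_nonneg.2 h1) (hv b)) (mul_nonneg h0 (hu b))
    have h2 : 0 ≤ ρ * (ρ * ((v b - u b) * S)) :=
      mul_nonneg h0 (mul_nonneg h0 (mul_nonneg (sub_nonneg.2 (huv b)) hS0))
    rw [hsum, Finset.prod_insert hb, Finset.prod_insert hb]
    calc v b * P - ρ * ((v b - u b) * P + v b * S)
        ≤ ((1 - ρ) * v b + ρ * u b) * (P - ρ * S) := by linarith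
      _ ≤ _ := mul_le_mul_of_nonneg_left ih hw

/-- If exactly one index `a` is chosen, with each index having probability at least `ρ`, and the
factor of the chosen index is lowered from `v a` to `u a`, then the mean of the product is at most
what it would be if the factors were lowered independently with probability `ρ`. -/
theorem sum_mul_prod_ite_le_prod {ι : Type*} [Fintype ι] [DecidableEq ι] {p u v : ι → ℝ} {ρ : ℝ}
    (h0 : 0 ≤ ρ) (h1 : ρ ≤ 1) (hu : ∀ i, 0 ≤ u i) (huv : ∀ i, u i ≤ v i) (hp : ∀ i, ρ ≤ p i)
    (hp1 : ∑ i, p i = 1) :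
    ∑ a, p a * ∏ i, (if i = a then u i else v i) ≤ ∏ i, ((1 - ρ) * v i + ρ * u i) := by
  have hv : ∀ i, 0 ≤ v i := fun i => (hu i).trans (huv i)
  calc ∑ a, p a * ∏ i, (if i = a then u i else v i)
      = (∑ a, p a) * ∏ i, v i - ∑ a, p a * (∏ i, v i - ∏ i, if i = a then u i else v i) := by
        rw [Finset.sum_mul, ← Finset.sum_sub_distrib]
        exact Finset.sum_congr rfl fun a _ => by ring
    _ ≤ ∏ i, v i - ρ * ∑ a, (∏ i, v i - ∏ i, if i = a then u i else v i) := by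
        rw [hp1, one_mul, Finset.mul_sum]
        refine sub_le_sub_left (Finset.sum_le_sum fun a _ =>
          mul_le_mul_of_nonneg_right (hp a) (sub_nonneg.2 ?_)) _
        exact Finset.prod_le_prod (fun i _ => by split_ifs <;> simp [hu, hv]) fun i _ => by
          split_ifs <;> simp [huv]
    _ ≤ _ := prod_sub_sum_le_prod Finset.univ h0 h1 hu huv

/-- If the gap after `j * n` balls is less than `g`, then at least `n / (g + 1)` bins have at
least the average load `j`. -/
theorem div_le_card_load_ge {n : ℕ} [NeZero n] (q : Query n) (ω : ℕ → Round n) (j : ℕ) {g : ℝ}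
    (hg0 : 0 < g) (hg : gap q ω (j * n) < g) :
    (n : ℝ) / (g + 1) ≤ (Finset.univ.filter fun i => j ≤ load q ω (j * n) i).card := by
  have hn : (n : ℝ) ≠ 0 := Nat.cast_ne_zero.2 (NeZero.ne n)
  have hle : ∀ i, (load q ω (j * n) i : ℝ) ≤
      j - 1 + (g + 1) * if j ≤ load q ω (j * n) i then 1 else 0 := by
    intro i
    split_ifs with h
    · have := load_le_gap_add q ω (j * n) i
      push_cast at this
      rw [mul_div_cancel_right₀ _ hn] at this
      linarith
    · have : ((load q ω (j * n) i + 1 : ℕ) : ℝ) ≤ j := Nat.cast_le.2 (not_le.1 h)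
      push_cast at this
      linarith
  have hsum := Finset.sum_le_sum fun i (_ : i ∈ Finset.univ) => hle i
  rw [← Nat.cast_sum, sum_load, Finset.sum_add_distrib, ← Finset.mul_sum, Finset.sum_boole,
    Finset.sum_const, Finset.card_univ, Fintype.card_fin, nsmul_eq_mul] at hsum
  push_cast at hsum
  rw [div_le_iff₀ (by linarith)]
  linarith

/-- In a window of `n` steps that starts with a gap below `g` and in which at least `M` queries
have `D` or more heavy bins, some bin very likely climbs to `r` balls above the average load `j`
at the start. Each of the at least `n / (g + 1)` bins that start with average load or more does so
with at least a binomial probability, and the bins are negatively dependent. -/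
theorem measureReal_window_le {n : ℕ} [NeZero n] (q : Query n) {D g : ℝ} (hD0 : 0 ≤ D)
    (hD1 : D ≤ n) (hg0 : 0 < g) (j r M : ℕ) :
    (roundLaw n).real {ω | gap q ω (j * n) < g ∧
        M ≤ bigCount D q ω (j * n) ((j + 1) * n) ∧ ∀ i, load q ω ((j + 1) * n) i < j + r} ≤
      Real.exp (-(n / (g + 1) * binomialTail (D / (n : ℝ) ^ 2) r M)) := by
  classical
  have hn1 : (1 : ℝ) ≤ n := by exact_mod_cast NeZero.one_le
  set ρ : ℝ := D / (n : ℝ) ^ 2 with hρ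
  have h0 : 0 ≤ ρ := by positivity
  have h1 : ρ ≤ 1 := by
    rw [hρ, div_le_one (by positivity)]
    nlinarith
  set w := binomialTail ρ with hw
  have hw1 : ∀ a b, 0 ≤ 1 - w a b := fun a b => sub_nonneg.2 (binomialTail_le_one h0 h1 a b)
  set s := j * n with hs
  -- The number of balls that bin `i` still needs, and the number of useful steps still to come,
  -- are truncated at zero.
  set Z : ℕ → (ℕ → Round n) → ℝ := fun t ω =>
    ∏ i, (1 - w (j + r - load q ω t i) (M - bigCount D q ω s t)) with hZ
  set X : ℕ → (ℕ → Round n) → ℝ := fun t ω => if s ≤ t ∧ gap q ω s < g then Z t ω else 0 with hX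
  have hZ0 : ∀ t ω, 0 ≤ Z t ω := fun t ω => Finset.prod_nonneg fun i _ => hw1 _ _
  refine measureReal_le_of_supermartingale X (s := s) (T := (j + 1) * n)
    (Nat.mul_le_mul_right n j.le_succ) ?_ ?_ ?_ ?_ ?_
  · intro t ω
    simp only [hX]
    split_ifs
    exacts [hZ0 t ω, le_rfl]
  · intro t ω ω' h
    have hZe : Z t ω = Z t ω' := by simp only [hZ, load_congr q h, bigCount_congr D q s h]
    have hc : (s ≤ t ∧ gap q ω s < g) ↔ (s ≤ t ∧ gap q ω' s < g) :=
      and_congr_right fun hst => by rw [gap_congr q (past_eq_past_of_le hst h)]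
    simp only [hX, hZe, hc]
  · intro t hst _ ω
    have hgap : ∀ r, gap q (Function.update ω t r) s = gap q ω s := fun r =>
      gap_congr q (past_update ω hst r)
    have hst' : s ≤ t + 1 := hst.trans t.le_succ
    by_cases hg : gap q ω s < g
    swap
    · simp [hX, hgap, hg]
    simp only [hX, hgap, hg, hst, hst', and_self, if_true]
    set H := heavySet q ω t with hH
    set B := bigCount D q ω s t with hB
    set x := load q ω t with hx
    have hcount : ∀ r, bigCount D q (Function.update ω t r) s (t + 1) =
        B + if D ≤ H.ncard then 1 else 0 := by
      intro r
      rw [bigCount_succ D q _ hst, bigCount_congr D q s (past_update ω le_rfl r),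
        heavySet_congr q (past_update ω le_rfl r)]
    by_cases hbig : D ≤ H.ncard ∧ B < M
    · obtain ⟨b, hb⟩ : ∃ b, M - B = b + 1 := ⟨M - B - 1, by omega⟩
      have hb' : M - (B + 1) = b := by omega
      have hZr : ∀ a, Z (t + 1) (Function.update ω t a) =
          ∏ i, if i = place (· ∈ H) a then 1 - w (j + r - x i - 1) b
            else 1 - w (j + r - x i) b := by
        intro a
        simp only [hZ]
        refine Finset.prod_congr rfl fun i _ => ?_
        rw [hcount, if_pos hbig.1, hb', load_update_succ, ← hH, ← hx]
        split_ifs with hi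
        · subst hi
          rw [Pi.add_apply, Pi.single_eq_same, Nat.sub_add_eq]
        · rw [Pi.add_apply, Pi.single_eq_of_ne hi, add_zero]
      have hZt : Z t ω = ∏ i, ((1 - ρ) * (1 - w (j + r - x i) b) +
          ρ * (1 - w (j + r - x i - 1) b)) := by
        simp only [hZ]
        refine Finset.prod_congr rfl fun i _ => ?_
        rw [← hB, hb, hw, binomialTail_succ_right]
        ring
      rw [Finset.sum_congr rfl fun a _ => hZr a, sum_place H fun a =>
        ∏ i, if i = a then 1 - w (j + r - x i - 1) b else 1 - w (j + r - x i) b, hZt]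
      refine mul_le_mul_of_nonneg_left (sum_mul_prod_ite_le_prod h0 h1 (fun i => hw1 _ _)
        (fun i => ?_) (fun i => ?_) (sum_placeProb H)) (by positivity)
      · exact sub_le_sub_left (binomialTail_antitone_left h0 h1 b (Nat.sub_le _ 1)) _
      · refine le_trans ?_ (ncard_div_le_placeProb H i)
        rw [hρ]
        gcongr
        exact hbig.1
    · have hle : ∀ a, Z (t + 1) (Function.update ω t a) ≤ Z t ω := by
        intro a
        refine Finset.prod_le_prod (fun i _ => hw1 _ _) fun i _ => ?_
        have hrem : M - bigCount D q (Function.update ω t a) s (t + 1) = M - B := by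
          rw [hcount]
          split_ifs with hc
          · have : ¬ B < M := fun h => hbig ⟨hc, h⟩
            omega
          · rfl
        rw [hrem, load_update_succ]
        refine sub_le_sub_left (binomialTail_antitone_left h0 h1 _ ?_) _
        exact Nat.sub_le_sub_left (Nat.le_add_right _ _) _
      calc ∑ a, Z (t + 1) (Function.update ω t a) ≤ ∑ _a : Round n, Z t ω :=
            Finset.sum_le_sum fun a _ => hle a
        _ = 2 * (n : ℝ) ^ 2 * Z t ω := by
            rw [Finset.sum_const, Finset.card_univ, card_round, nsmul_eq_mul]
            push_cast
            ring
  · intro ω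
    simp only [hX]
    split_ifs with h
    · set S := Finset.univ.filter fun i => j ≤ load q ω s i with hS
      have hcard : (n : ℝ) / (g + 1) ≤ S.card := div_le_card_load_ge q ω j hg0 h.2
      calc Z s ω ≤ ∏ i, if i ∈ S then 1 - w r M else 1 := by
            refine Finset.prod_le_prod (fun i _ => hw1 _ _) fun i _ => ?_
            rw [bigCount_self, Nat.sub_zero]
            split_ifs with hi
            · refine sub_le_sub_left (binomialTail_antitone_left h0 h1 M ?_) _
              have : j ≤ load q ω s i := (Finset.mem_filter.1 hi).2
              omega
            · exact sub_le_self _ (binomialTail_nonneg h0 h1 _ _)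
        _ = (1 - w r M) ^ S.card := by
            rw [Finset.prod_ite_mem, Finset.univ_inter, Finset.prod_const]
        _ ≤ Real.exp (-w r M) ^ S.card :=
            pow_le_pow_left₀ (hw1 _ _) (Real.one_sub_le_exp_neg _) _
        _ = Real.exp (-(S.card * w r M)) := by
            rw [← Real.exp_nat_mul]
            ring_nf
        _ ≤ _ := by
            refine Real.exp_le_exp.2 (neg_le_neg ?_)
            exact mul_le_mul_of_nonneg_right hcard (binomialTail_nonneg h0 h1 _ _)
    · exact (Real.exp_pos _).le
  · rintro ω ⟨hg, hM, hlt⟩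
    simp only [hX]
    rw [if_pos ⟨Nat.mul_le_mul_right n j.le_succ, hg⟩]
    refine le_of_eq (Eq.symm (Finset.prod_eq_one fun i _ => ?_))
    obtain ⟨d, hd⟩ : ∃ d, j + r - load q ω ((j + 1) * n) i = d + 1 :=
      ⟨j + r - load q ω ((j + 1) * n) i - 1, by have := hlt i; omega⟩
    rw [hd, Nat.sub_eq_zero_of_le hM]
    simp [hw, binomialTail]

/-! ### The gap of an arbitrary one-query process -/

theorem gap_zero {n : ℕ} (q : Query n) (ω : ℕ → Round n) : gap q ω 0 = 0 := by
  have : (Finset.univ : Finset (Fin n)).sup (load q ω 0) = 0 :=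
    (Finset.sup_eq_bot_iff _ _).2 fun _ _ => rfl
  simp [gap, this]

/-- If every one of `W` consecutive windows of length `n` has fewer than `M` big steps, then
there are at most `W * M` of them altogether. -/
theorem bigCount_le_mul {n : ℕ} (D : ℝ) (q : Query n) (ω : ℕ → Round n) {W M : ℕ}
    (h : ∀ j < W, bigCount D q ω (j * n) ((j + 1) * n) ≤ M) :
    bigCount D q ω 0 (W * n) ≤ W * M := by
  induction W with
  | zero => simp [bigCount_self]
  | succ W ih =>
    rw [bigCount_add D q ω (Nat.zero_le (W * n)) (Nat.mul_le_mul_right n W.le_succ), add_one_mul]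
    exact add_le_add (ih fun j hj => h j (hj.trans W.lt_succ_self)) (h W W.lt_succ_self)

theorem measureReal_forall_gap_lt_le {n : ℕ} [NeZero n] (hn : 6 ≤ n) {α : ℝ} (h0 : 0 < α)
    (h1 : α ≤ 1) (q : Query n) {r : ℕ} (hr : 1 / α + 1 ≤ r) (W M : ℕ) :
    (roundLaw n).real {ω | ∀ s ≤ W * n, gap q ω s < 1 / α} ≤
      Real.exp (1 / 576 * (2 * n - α ^ 2 / 16 * (W * n - W * M) + 3 * α * (W * M))) +
      W * Real.exp (-(n / (1 / α + 1) * binomialTail (α * n / 48 / (n : ℝ) ^ 2) r M)) := by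
  have hn0 : (n : ℝ) ≠ 0 := Nat.cast_ne_zero.2 (NeZero.ne n)
  have hn1 : (0 : ℝ) ≤ n := Nat.cast_nonneg n
  set D : ℝ := α * n / 48 with hD
  set B : ℕ → Set (ℕ → Round n) := fun j => {ω | gap q ω (j * n) < 1 / α ∧
    M ≤ bigCount D q ω (j * n) ((j + 1) * n) ∧ ∀ i, load q ω ((j + 1) * n) i < j + r} with hB
  have hsub : {ω | ∀ s ≤ W * n, gap q ω s < 1 / α} ⊆
      {ω | (∀ s ≤ W * n, gap q ω s < 1 / α) ∧ (bigCount D q ω 0 (W * n) : ℝ) ≤ (W * M : ℝ)} ∪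
        ⋃ j ∈ Finset.range W, B j := by
    intro ω (hω : ∀ s ≤ W * n, gap q ω s < 1 / α)
    by_cases hc : ∀ j < W, bigCount D q ω (j * n) ((j + 1) * n) ≤ M
    · exact Or.inl ⟨hω, by exact_mod_cast bigCount_le_mul D q ω hc⟩
    · push Not at hc
      obtain ⟨j, hj, hM⟩ := hc
      refine Or.inr (Set.mem_biUnion (Finset.mem_range.2 hj)
        ⟨hω _ (Nat.mul_le_mul_right n hj.le), hM.le, fun i => ?_⟩)
      have h2 := load_le_gap_add q ω ((j + 1) * n) i
      have h3 := hω _ (Nat.mul_le_mul_right n (Nat.succ_le_of_lt hj))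
      rw [Nat.cast_mul, mul_div_cancel_right₀ _ hn0] at h2
      have h4 : (load q ω ((j + 1) * n) i : ℝ) < ((j + r : ℕ) : ℝ) := by
        push_cast at h2 ⊢
        linarith
      exact_mod_cast h4
  have hA := measureReal_gap_lt_and_bigCount_le hn h0 h1 q (W * n) (W * M)
  rw [Nat.cast_mul] at hA
  calc _ ≤ _ := measureReal_mono hsub (measure_ne_top _ _)
    _ ≤ _ := measureReal_union_le _ _
    _ ≤ _ := add_le_add hA (measureReal_biUnion_finset_le _ _)
    _ ≤ _ := by
      refine add_le_add le_rfl ((Finset.sum_le_sum fun j _ => measureReal_window_le q (D := D)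
        (by positivity) ?_ (one_div_pos.2 h0) j r M).trans_eq ?_)
      · rw [hD]
        nlinarith
      · rw [Finset.sum_const, Finset.card_range, nsmul_eq_mul]

/-! ### Choice of parameters -/

/-- A lower bound for the binomial tail through the single term `r` of the binomial distribution,
for at most `1 / 2` expected successes. -/
theorem half_mul_pow_le_binomialTail {ρ c : ℝ} (h0 : 0 ≤ ρ) {r M : ℕ} (hr : 0 < r)
    (hM : M * ρ ≤ 1 / 2) (hM1 : 1 ≤ M) (hc0 : 0 ≤ c) (hc : c * r ≤ ((M + 1 - r : ℕ) : ℝ) * ρ) :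
    1 / 2 * c ^ r ≤ binomialTail ρ r M := by
  have hM1' : (1 : ℝ) ≤ M := by exact_mod_cast hM1
  have h1 : ρ ≤ 1 := by nlinarith
  have hpow : 1 / 2 ≤ (1 - ρ) ^ M := by
    have h := one_add_mul_le_pow (a := -ρ) (by linarith) M
    rw [← sub_eq_add_neg] at h
    linarith
  have hfac : (r.factorial : ℝ) ≤ (r : ℝ) ^ r := by exact_mod_cast Nat.factorial_le_pow r
  have hch : c ^ r ≤ M.choose r * ρ ^ r := by
    have h2 := Nat.pow_le_choose (α := ℝ) r M
    rw [div_le_iff₀ (by positivity)] at h2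
    have h3 : (c * r) ^ r ≤ (((M + 1 - r : ℕ) : ℝ) * ρ) ^ r :=
      pow_le_pow_left₀ (by positivity) hc r
    rw [mul_pow, mul_pow] at h3
    have hrr : (0 : ℝ) < (r : ℝ) ^ r := by positivity
    refine le_of_mul_le_mul_right ?_ hrr
    calc c ^ r * (r : ℝ) ^ r ≤ ((M + 1 - r : ℕ) : ℝ) ^ r * ρ ^ r := h3
      _ ≤ M.choose r * r.factorial * ρ ^ r := by gcongr
      _ ≤ M.choose r * (r : ℝ) ^ r * ρ ^ r := by gcongr
      _ = M.choose r * ρ ^ r * (r : ℝ) ^ r := by ring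
  refine le_trans ?_ (choose_mul_pow_le_binomialTail h0 h1 r M)
  rw [mul_comm]
  exact mul_le_mul hch hpow (by norm_num) (by positivity)

/-- The gain `α ^ 2 / 16` of the small steps outweighs both the loss `3 * α` of the at most `W * M`
big steps and the range of the potential. -/
theorem drift_exponent_le {α n W M : ℝ} (h0 : 0 ≤ α) (h1 : α ≤ 1) (hn : 0 ≤ n) (hW : 0 ≤ W)
    (hM : M ≤ α * n / 100) (hαW : 200 ≤ α ^ 2 * W) :
    2 * n - α ^ 2 / 16 * (W * n - W * M) + 3 * α * (W * M) ≤ -(2 * n) := by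
  have hMn : M ≤ n / 100 := hM.trans (by nlinarith)
  have h2 : α * W * M ≤ α * W * (α * n / 100) := mul_le_mul_of_nonneg_left hM (by positivity)
  have h3 : α ^ 2 * W * M ≤ α ^ 2 * W * (n / 100) :=
    mul_le_mul_of_nonneg_left hMn (by positivity)
  have h4 : 200 * n ≤ α ^ 2 * W * n := mul_le_mul_of_nonneg_right hαW hn
  linarith

/-- The binomial tail for `M ≈ α * n / 100` trials with success probability `α / (48 * n)`, at a
level `r` with `r * log L ≤ L / 6`. -/
theorem half_mul_exp_le_binomialTail {n L α : ℝ} {r M : ℕ} (hn : 0 < n) (hL : 0 < L)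
    (h0 : 0 < α) (h1 : α ≤ 1) (hr : 0 < r) (hrL : (r : ℝ) ≤ L / 50) (hαL : 192 ≤ (α * L) ^ 2)
    (hMn : M ≤ α * n / 100) (hMn' : α * n / 100 < M + 1) (hαn : 100 * L ≤ α * n) (hL1 : 1 ≤ L)
    (hrK : 3 * r * Real.log L ≤ L / 2) :
    1 / 2 * Real.exp (-(L / 2)) ≤ binomialTail (α * n / 48 / n ^ 2) r M := by
  set ρ : ℝ := α * n / 48 / n ^ 2 with hρ
  have hρn : ρ = α / 48 / n := by
    rw [hρ]
    field_simp
  have hρ0 : 0 ≤ ρ := by positivity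
  have hMr : α * n / 200 ≤ ((M + 1 - r : ℕ) : ℝ) := by
    have h2 : r ≤ M + 1 := by
      have : (r : ℝ) ≤ ((M + 1 : ℕ) : ℝ) := by
        push_cast
        linarith
      exact_mod_cast this
    rw [Nat.cast_sub h2]
    push_cast
    linarith
  have hM1 : 1 ≤ M := by
    have : (0 : ℝ) < M := by linarith
    exact_mod_cast this
  have hpow : Real.exp (-(L / 2)) ≤ (1 / L ^ 3) ^ r := by
    have : 1 / L ^ 3 = Real.exp (-(3 * Real.log L)) := by
      have h3 : Real.exp (3 * Real.log L) = L ^ 3 := by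
        rw [mul_comm, Real.exp_mul, Real.exp_log hL]
        norm_cast
      rw [Real.exp_neg, h3, one_div]
    rw [this, ← Real.exp_nat_mul, Real.exp_le_exp]
    linarith
  refine (mul_le_mul_of_nonneg_left hpow (by norm_num)).trans
    (half_mul_pow_le_binomialTail hρ0 hr ?_ hM1 (by positivity) ?_)
  · calc (M : ℝ) * ρ ≤ α * n / 100 * ρ := mul_le_mul_of_nonneg_right hMn hρ0
      _ = α ^ 2 / 4800 := by
        rw [hρn]
        field_simp
        norm_num
      _ ≤ 1 / 2 := by nlinarith
  · calc 1 / L ^ 3 * (r : ℝ) ≤ 1 / L ^ 3 * (L / 50) :=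
          mul_le_mul_of_nonneg_left hrL (by positivity)
      _ = 192 / (9600 * L ^ 2) := by
        field_simp
        norm_num
      _ ≤ (α * L) ^ 2 / (9600 * L ^ 2) := div_le_div_of_nonneg_right hαL (by positivity)
      _ = α * n / 200 * ρ := by
        rw [hρn]
        field_simp
        norm_num
      _ ≤ _ := mul_le_mul_of_nonneg_right hMr hρ0

/-- With `g = log n / (8 * log (log n))`, the gap stays below `g` during the first `n * log n ^ 2`
steps with probability at most `2 / n ^ 3`, for all `n` that are large in the explicit sense of
the hypotheses. -/
theorem measureReal_compl_largeMaxGap_le {n : ℕ} [NeZero n] (q : Query n)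
    (hLL : 13 ≤ Real.log (Real.log n)) (hL : 48 * Real.log (Real.log n) ≤ Real.log n)
    (hexp : 64 * Real.log n ^ 4 ≤ n) :
    (roundLaw n).real (largeMaxGap q)ᶜ ≤ 2 / (n : ℝ) ^ 3 := by
  have hn0 : (0 : ℝ) < n := Nat.cast_pos.2 (NeZero.pos n)
  set L := Real.log n with hLdef
  set K := Real.log L with hKdef
  have hL0 : 0 < L := by linarith
  have hL1 : 624 ≤ L := by linarith
  have hK0 : 0 < K := by linarith
  have hnexp : (n : ℝ) = Real.exp L := (Real.exp_log hn0).symm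
  have hLexp : L = Real.exp K := (Real.exp_log hL0).symm
  have hLL2 : 2 * L ≤ L ^ 2 := by
    rw [sq]
    exact mul_le_mul_of_nonneg_right (by linarith) hL0.le
  have hK2 : 13 ^ 2 ≤ K ^ 2 := pow_le_pow_left₀ (by norm_num) hLL 2
  have hL2n : 1000 * L ^ 2 ≤ n := by
    have h2 : 1000 ≤ 64 * L ^ 2 := by linarith
    calc 1000 * L ^ 2 ≤ 64 * L ^ 2 * L ^ 2 := mul_le_mul_of_nonneg_right h2 (sq_nonneg L)
      _ = 64 * L ^ 4 := by ring
      _ ≤ n := hexp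
  have hLn : 1152 * L ≤ n := by linarith
  have hn6 : 6 ≤ n := by
    have : (6 : ℝ) ≤ n := by linarith
    exact_mod_cast this
  set α : ℝ := 8 * K / L with hα
  have hα0 : 0 < α := by positivity
  have hαL : α * L = 8 * K := by
    rw [hα]
    field_simp
  have hα1 : α ≤ 1 := by
    rw [hα, div_le_one hL0]
    linarith
  have hg : 1 / α = 1 / 8 * (L / K) := by
    rw [hα]
    field_simp
  have hgK : 1 / α * K = L / 8 := by
    rw [hg]
    field_simp
  have hg0 : 0 < 1 / α := by positivity
  set W := ⌊L ^ 2⌋₊ with hW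
  set M := ⌊α * n / 100⌋₊ with hM
  set r := ⌈1 / α⌉₊ + 1 with hr
  have hr1 : 1 / α + 1 ≤ r := by
    rw [hr]
    push_cast
    linarith [Nat.le_ceil (1 / α)]
  have hr2 : (r : ℝ) ≤ 1 / α + 2 := by
    rw [hr]
    push_cast
    linarith [Nat.ceil_lt_add_one hg0.le]
  have hrL : (r : ℝ) ≤ L / 50 := by
    have : 1 / α * 13 ≤ L / 8 := hgK ▸ mul_le_mul_of_nonneg_left hLL hg0.le
    linarith
  have hgL : 1 / α + 1 ≤ L := by linarith
  have hWL : (W : ℝ) ≤ L ^ 2 := Nat.floor_le (by positivity)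
  have hWL' : L ^ 2 / 2 ≤ W := by
    have := Nat.lt_floor_add_one (L ^ 2)
    rw [← hW] at this
    linarith
  have hMn : (M : ℝ) ≤ α * n / 100 := Nat.floor_le (by positivity)
  have hMn' : α * n / 100 < M + 1 := Nat.lt_floor_add_one _
  have hαn : 100 * L ≤ α * n := by
    calc 100 * L ≤ 8000 * 13 * L := by linarith
      _ ≤ 8000 * K * L := by gcongr
      _ = α * L * (1000 * L) := by
        rw [hαL]
        ring
      _ = α * (1000 * L ^ 2) := by ring
      _ ≤ α * n := by gcongr
  -- The drift of the potential during few big steps exceeds the range of the potential.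
  have hA : Real.exp (1 / 576 * (2 * n - α ^ 2 / 16 * (W * n - W * M) + 3 * α * (W * M))) ≤
      Real.exp (-(4 * L)) := by
    refine Real.exp_le_exp.2 ?_
    have hαW : 200 ≤ α ^ 2 * W := by
      calc (200 : ℝ) ≤ 32 * K ^ 2 := by linarith
        _ = (α * L) ^ 2 / 2 := by
          rw [hαL]
          ring
        _ = α ^ 2 * (L ^ 2 / 2) := by ring
        _ ≤ α ^ 2 * W := by gcongr
    have := drift_exponent_le hα0.le hα1 hn0.le (Nat.cast_nonneg W) hMn hαW
    linarith
  -- A window with `M` big steps is long enough for some bin to receive `r` balls.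
  have hB : Real.exp (-(n / (1 / α + 1) * binomialTail (α * n / 48 / (n : ℝ) ^ 2) r M)) ≤
      Real.exp (-(4 * L)) := by
    refine Real.exp_le_exp.2 (neg_le_neg ?_)
    have htail : 1 / 2 * Real.exp (-(L / 2)) ≤
        binomialTail (α * n / 48 / (n : ℝ) ^ 2) r M := by
      refine half_mul_exp_le_binomialTail hn0 hL0 hα0 hα1 (Nat.succ_pos _) hrL ?_ hMn hMn' hαn ?_ ?_
      · rw [hαL, mul_pow]
        linarith
      · linarith
      · calc 3 * r * K ≤ 3 * (1 / α + 2) * K := by gcongr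
          _ = 3 * (1 / α * K) + 6 * K := by ring
          _ ≤ L / 2 := by
            rw [hgK]
            linarith
    have hsqrt : 8 * L ^ 2 ≤ Real.exp (L / 2) := by
      refine le_of_sq_le_sq ?_ (Real.exp_pos _).le
      rw [← Real.exp_nat_mul]
      have : ((2 : ℕ) : ℝ) * (L / 2) = L := by
        push_cast
        ring
      rw [this, ← hnexp]
      linarith
    calc 4 * L = 8 * L ^ 2 / (2 * L) := by
          field_simp
          norm_num
      _ ≤ Real.exp (L / 2) / (2 * L) := by gcongr
      _ = n / L * (1 / 2 * Real.exp (-(L / 2))) := by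
          have : (n : ℝ) = Real.exp (L / 2) * Real.exp (L / 2) := by
            rw [← Real.exp_add, add_halves, ← hnexp]
          rw [this, Real.exp_neg]
          field_simp
      _ ≤ n / (1 / α + 1) * binomialTail (α * n / 48 / (n : ℝ) ^ 2) r M :=
          mul_le_mul (div_le_div_of_nonneg_left hn0.le (by positivity) hgL) htail (by positivity)
            (by positivity)
  have hsub : (largeMaxGap q)ᶜ ⊆ {ω | ∀ s ≤ W * n, gap q ω s < 1 / α} := by
    intro ω hω s hs
    rcases Nat.eq_zero_or_pos s with rfl | hs0
    · rwa [gap_zero]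
    · rw [hg]
      refine lt_of_not_ge fun h => hω ⟨s, hs0, ?_, h⟩
      calc (s : ℝ) ≤ W * n := by exact_mod_cast hs
        _ ≤ L ^ 2 * n := by gcongr
        _ = n * L ^ 2 := mul_comm _ _
  have hnL : Real.exp (-(4 * L)) = 1 / (n : ℝ) ^ 4 := by
    rw [hnexp, ← Real.exp_nat_mul, Real.exp_neg]
    simp
  calc _ ≤ _ := measureReal_mono hsub (measure_ne_top _ _)
    _ ≤ _ := measureReal_forall_gap_lt_le hn6 hα0 hα1 q hr1 W M
    _ ≤ Real.exp (-(4 * L)) + L ^ 2 * Real.exp (-(4 * L)) :=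
      add_le_add hA (mul_le_mul hWL hB (Real.exp_pos _).le (by positivity))
    _ = (1 + L ^ 2) / (n : ℝ) ^ 4 := by
      rw [hnL]
      ring
    _ ≤ 2 * n / (n : ℝ) ^ 4 := by
      gcongr
      linarith
    _ = 2 / (n : ℝ) ^ 3 := by
      field_simp

theorem eventually_measureReal_compl_largeMaxGap_le :
    ∃ N : ℕ, ∀ (n : ℕ) [NeZero n], N ≤ n → ∀ q : Query n,
      (roundLaw n).real (largeMaxGap q)ᶜ ≤ 2 / (n : ℝ) ^ 3 := by
  have hlog : Tendsto (fun n : ℕ => Real.log n) atTop atTop :=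
    Real.tendsto_log_atTop.comp tendsto_natCast_atTop_atTop
  have h1 : ∀ᶠ n : ℕ in atTop, 13 ≤ Real.log (Real.log n) :=
    (Real.tendsto_log_atTop.comp hlog).eventually_ge_atTop 13
  have h2 : ∀ᶠ n : ℕ in atTop, 48 * Real.log (Real.log n) ≤ Real.log n := by
    have h : ∀ᶠ x : ℝ in atTop, 48 * Real.log x ≤ x := by
      filter_upwards [Real.isLittleO_log_id_atTop.bound (by norm_num : (0 : ℝ) < 1 / 48),
        eventually_ge_atTop 1] with x hx hx1
      rw [Real.norm_eq_abs, Real.norm_eq_abs, id, abs_of_nonneg (Real.log_nonneg hx1),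
        abs_of_nonneg (by linarith)] at hx
      linarith
    exact hlog.eventually h
  have h3 : ∀ᶠ n : ℕ in atTop, 64 * Real.log n ^ 4 ≤ n := by
    have h : ∀ᶠ x : ℝ in atTop, 64 * x ^ 4 ≤ Real.exp x := by
      filter_upwards [(Real.tendsto_exp_div_pow_atTop 4).eventually_ge_atTop 64,
        eventually_gt_atTop 0] with x hx hx0
      rwa [le_div_iff₀ (by positivity)] at hx
    filter_upwards [hlog.eventually h, eventually_gt_atTop 0] with n hn hn0
    rwa [Real.exp_log (Nat.cast_pos.2 hn0)] at hn
  obtain ⟨N, hN⟩ := eventually_atTop.1 (h1.and (h2.and h3))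
  exact ⟨N, fun n _ hn q =>
    measureReal_compl_largeMaxGap_le q (hN n hn).1 (hN n hn).2.1 (hN n hn).2.2⟩

theorem one_sub_measureReal_compl_le {n : ℕ} [NeZero n] (A : Set (ℕ → Round n)) :
    1 - (roundLaw n).real Aᶜ ≤ (roundLaw n).real A := by
  have h := measureReal_union_le (μ := roundLaw n) A Aᶜ
  rw [Set.union_compl_self, probReal_univ] at h
  linarith

/-- The maximum load never decreases, so the gap decreases by at most `1 / n` per ball. -/
theorem gap_sub_le_gap {n : ℕ} (q : Query n) (ω : ℕ → Round n) {t s : ℕ} (hts : t ≤ s) :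
    gap q ω t - ((s : ℝ) - t) / n ≤ gap q ω s := by
  have h : ((Finset.univ.sup (load q ω t) : ℕ) : ℝ) ≤ (Finset.univ.sup (load q ω s) : ℕ) :=
    Nat.cast_le.2 (Finset.sup_mono_fun fun i _ => load_mono q ω hts i)
  rw [gap, gap, sub_div]
  linarith

theorem largeMaxGap_subset_largeGapWindow {n : ℕ} [NeZero n] (q : Query n) :
    largeMaxGap q ⊆ largeGapWindow q := by
  rintro ω ⟨t, ht1, ht, hgap⟩
  refine ⟨t, ht1, ht, fun s hts hs => ?_⟩
  have hn0 : (0 : ℝ) < n := Nat.cast_pos.2 (NeZero.pos n)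
  have h : ((s : ℝ) - t) / n ≤ 1 / 16 * (Real.log n / Real.log (Real.log n)) := by
    rw [div_le_iff₀ hn0]
    linarith
  linarith [gap_sub_le_gap q ω hts]

end BallsIntoBins

end

theorem mainTheorem3 :
    (∃ ε : ℕ → ℝ, (ε =o[atTop] fun n : ℕ => ((n : ℝ) ^ 2)⁻¹) ∧
      ∀ (n : ℕ) [NeZero n],
        (∀ Q : BallsIntoBins.QuantileProcess n,
          1 - ε n ≤ (BallsIntoBins.roundLaw n).real (BallsIntoBins.largeMaxGap Q.query)) ∧
        (∀ F : BallsIntoBins.ThresholdProcess n,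
          1 - ε n ≤ (BallsIntoBins.roundLaw n).real (BallsIntoBins.largeMaxGap F.query))) ∧
    (∃ N : ℕ, ∀ (n : ℕ) [NeZero n], N ≤ n →
        (∀ Q : BallsIntoBins.QuantileProcess n,
          1 - ((n : ℝ) ^ 2)⁻¹ ≤
            (BallsIntoBins.roundLaw n).real (BallsIntoBins.largeGapWindow Q.query)) ∧
        (∀ F : BallsIntoBins.ThresholdProcess n,
          1 - ((n : ℝ) ^ 2)⁻¹ ≤
            (BallsIntoBins.roundLaw n).real (BallsIntoBins.largeGapWindow F.query))) := by
  obtain ⟨N, hN⟩ := BallsIntoBins.eventually_measureReal_compl_largeMaxGap_le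
  constructor
  · set ε : ℕ → ℝ := fun n => if N ≤ n then 2 / (n : ℝ) ^ 3 else 1 with hε
    have key : ∀ (n : ℕ) [NeZero n] (q : BallsIntoBins.Query n),
        1 - ε n ≤ (BallsIntoBins.roundLaw n).real (BallsIntoBins.largeMaxGap q) := by
      intro n _ q
      simp only [hε]
      split_ifs with hn
      · exact (sub_le_sub_left (hN n hn q) 1).trans (BallsIntoBins.one_sub_measureReal_compl_le _)
      · simp
    refine ⟨ε, ?_, fun n _ => ⟨fun Q => key n Q.query, fun F => key n F.query⟩⟩
    have hev : (fun n : ℕ => 2 / (n : ℝ) * ((n : ℝ) ^ 2)⁻¹) =ᶠ[atTop] ε := by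
      filter_upwards [eventually_ge_atTop N, eventually_gt_atTop 0] with n hn hn0
      have : (n : ℝ) ≠ 0 := Nat.cast_ne_zero.2 hn0.ne'
      simp only [hε, if_pos hn]
      field_simp
    refine (isLittleO_iff_exists_eq_mul.2 ⟨fun n : ℕ => 2 / (n : ℝ), ?_, hev.symm⟩)
    exact tendsto_const_div_atTop_nhds_zero_nat 2
  · refine ⟨max N 2, fun n _ hn => ?_⟩
    have key : ∀ q : BallsIntoBins.Query n, 1 - ((n : ℝ) ^ 2)⁻¹ ≤
        (BallsIntoBins.roundLaw n).real (BallsIntoBins.largeGapWindow q) := by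
      intro q
      have hn2 : (2 : ℝ) ≤ n := by exact_mod_cast (le_max_right N 2).trans hn
      have h : 2 / (n : ℝ) ^ 3 ≤ ((n : ℝ) ^ 2)⁻¹ := by
        rw [inv_eq_one_div, div_le_div_iff₀ (by positivity) (by positivity)]
        nlinarith [sq_nonneg (n : ℝ)]
      calc 1 - ((n : ℝ) ^ 2)⁻¹ ≤ 1 - 2 / (n : ℝ) ^ 3 := sub_le_sub_left h 1
        _ ≤ 1 - (BallsIntoBins.roundLaw n).real (BallsIntoBins.largeMaxGap q)ᶜ :=
          sub_le_sub_left (hN n ((le_max_left N 2).trans hn) q) 1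
        _ ≤ (BallsIntoBins.roundLaw n).real (BallsIntoBins.largeMaxGap q) :=
          BallsIntoBins.one_sub_measureReal_compl_le _
        _ ≤ _ := measureReal_mono (BallsIntoBins.largeMaxGap_subset_largeGapWindow q)
          (measure_ne_top _ _)
    exact ⟨fun Q => key Q.query, fun F => key F.query⟩
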